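/- Let $k:\mathbb{Z}\to\mathbb{R}$ be a symmetric, positive definite function (that is, $k(-t)=k(t)$ and $\sum_{i,j}x_ix_jk(i-j)\ge 0$ for every finitely supported real family $(x_i)_{i\in\mathbb{Z}}$) such that $\sum_{t\in\mathbb{Z}}|k(t)|=M<+\infty$, and let $f(\lambda)=\sum_{t\in\mathbb{Z}}\mathrm{e}^{\mathrm{i}\lambda t}k(t)$ be its spectral density, a real-valued function of $\lambda\in\mathbb{R}$. Let $0\le\alpha<1/(2M)$ (with $1/(2M)=+\infty$ if $M=0$). Then $1+2\alpha f>0$, $\log(1+2\alpha f)$ is integrable on $[0,2\pi]$, and the equation $$g(s)+2\alpha\sum_{r=0}^{+\infty}g(r)\,k(s-r)=\delta_{s,0}\qquad(s\in\mathbb{Z})$$ has a unique solution $g$ in $L^1(\mathbb{Z})$ (the absolutely summable real functions on $\mathbb{Z}$). One has $$g(0)=\exp\left(-\frac{1}{2\pi}\int_0^{2\pi}\log(1+2\alpha f(\lambda))\,\mathrm{d}\lambda\right)$$ and $$\sum_{s=0}^{+\infty}g(s)=\exp\left(-\frac12\log(1+2\alpha f(0))-\frac{1}{4\pi}\int_0^{2\pi}\log(1+2\alpha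 f(\lambda))\,\mathrm{d}\lambda\right).$$ Moreover, for every integer $t\ge 0$ the system $$g_t(s)+2\alpha\sum_{r=0}^{t}g_t(r)\,k(s-r)=\delta_{s,0}\qquad(0\le s\le t)$$ has a unique solution $(g_t(s))_{0\le s\le t}$, and, as $t\to+\infty$, $g_t(s)\to g(s)$ for every $s\ge 0$, and $$\sum_{s=0}^{t}g_t(s)\to\sum_{s=0}^{+\infty}g(s).$$ -/

import Mathlib

/-- A symmetric function `k : ℤ → ℝ` of positive type (the covariance function of a stationary
sequence): `k (-t) = k t`, and `∑ i, j, x i * k (i - j) * x j ≥ 0` for every finitely supported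
real family `x`. Both facts say that the infinite matrix `(k (i - j))` is symmetric and positive
semidefinite. -/
def IsPositiveDefiniteSymm (k : ℤ → ℝ) : Prop :=
  (Matrix.of fun i j : ℤ => k (i - j)).PosSemidef

/-- The terms `e^{i λ t} k(t)` of the Fourier series of `k`. -/
noncomputable def spectralTerm (k : ℤ → ℝ) (l : ℝ) (t : ℤ) : ℂ :=
  Complex.exp (Complex.I * (l : ℂ) * (t : ℂ)) * (k t : ℂ)

/-- The spectral density `f(λ) = ∑_{t ∈ ℤ} e^{i λ t} k(t)`. For a symmetric summable `k` the sum
is real, so that taking the real part changes nothing (the theorem states this too). -/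
noncomputable def spectralDensity (k : ℤ → ℝ) (l : ℝ) : ℝ :=
  (∑' t : ℤ, spectralTerm k l t).re

/-- `g` solves the half-line equation
`g(s) + 2 α ∑_{r ≥ 0} g(r) k(s - r) = δ_{s,0}` for all `s ∈ ℤ`, with convergent series. -/
def IsHalfLineSolution (α : ℝ) (k g : ℤ → ℝ) : Prop :=
  ∀ s : ℤ, Summable (fun r : ℕ => g r * k (s - r)) ∧
    g s + 2 * α * ∑' r : ℕ, g r * k (s - r) = if s = 0 then 1 else 0

/-- `h = (h(0), …, h(t))` solves the truncated system
`h(s) + 2 α ∑_{r=0}^{t} h(r) k(s - r) = δ_{s,0}` for `0 ≤ s ≤ t`. -/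
def IsTruncatedSolution (α : ℝ) (k : ℤ → ℝ) (t : ℕ) (h : Fin (t + 1) → ℝ) : Prop :=
  ∀ s : Fin (t + 1),
    h s + 2 * α * ∑ r : Fin (t + 1), h r * k (((s : ℕ) : ℤ) - ((r : ℕ) : ℤ)) =
      if s = 0 then 1 else 0

/-!
The function `a = 2αk` has norm less than one in the convolution algebra `ℓ¹(ℤ)`, so that
`L = log (1 + a)` is given there by the power series. Split `L = L₊ + L₋` into its restrictions to
the non-negative and to the negative integers. The Wiener–Hopf function `u = exp (-L₊)` is supported
on the non-negative integers, and `u * (1 + a) = exp L₋` agrees there with the unit `δ₀`; hence `u`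
is the non-negative part of the solution `g`. Its value at `0` is `exp (-L 0)`, where `L 0` is the
mean of the Fourier series `log (1 + 2αf)` of `L`. As `L` is even, `∑ L₊` is the half-sum of
`∑ L = log (1 + 2αf(0))` and `L 0`, which gives the sum of `u`. Since `‖a‖ < 1`, the truncated
operators are inverted by Neumann series with uniformly bounded inverses, so that the truncated
solutions converge to `u` in `ℓ¹(ℤ)`.
-/

open Filter Topology

section Convolution

variable {G R : Type*} [AddCommGroup G] [NormedRing R] {f g : G → R}

/-- The change of variables `(s, r) ↦ (r, s - r)`, which turns a sum over all pairs into a sum of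
convolution terms. -/
def convolutionEquiv (G : Type*) [AddCommGroup G] : G × G ≃ G × G where
  toFun p := (p.2, p.1 - p.2)
  invFun p := (p.1 + p.2, p.1)
  left_inv p := by simp
  right_inv p := by simp

theorem summable_norm_mul_sub (hf : Summable fun x => ‖f x‖) (hg : Summable fun x => ‖g x‖) :
    Summable fun p : G × G => ‖f p.2 * g (p.1 - p.2)‖ := by
  simpa [convolutionEquiv, Function.comp_def] using
    (convolutionEquiv G).summable_iff.2 (hf.mul_norm hg)

theorem tsum_tsum_mul_sub [CompleteSpace R] (hf : Summable fun x => ‖f x‖)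
    (hg : Summable fun x => ‖g x‖) :
    ∑' s, ∑' r, f r * g (s - r) = (∑' r, f r) * ∑' r, g r := by
  rw [tsum_mul_tsum_of_summable_norm hf hg, ← (convolutionEquiv G).tsum_eq]
  exact (summable_norm_mul_sub hf hg).of_norm.tsum_prod.symm

end Convolution

section LogOneAdd

variable {A : Type*} [NormedRing A] [NormedAlgebra ℝ A]

/-- The logarithm of `1 + a`, for `‖a‖ < 1`, as a power series; the term `n = 0` vanishes because
of the division by zero. -/
noncomputable def logOneAdd (a : A) : A := ∑' n : ℕ, ((-1 : ℝ) ^ (n + 1) / n) • a ^ n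

theorem summable_logOneAdd [CompleteSpace A] {a : A} (ha : ‖a‖ < 1) :
    Summable fun n : ℕ => ((-1 : ℝ) ^ (n + 1) / n) • a ^ n := by
  refine .of_norm_bounded (summable_norm_geometric_of_norm_lt_one ha) fun n => ?_
  rw [norm_smul]
  refine mul_le_of_le_one_left (norm_nonneg _) ?_
  rcases n.eq_zero_or_pos with rfl | hn
  · simp
  · simpa using inv_le_one_of_one_le₀ (by exact_mod_cast hn : (1 : ℝ) ≤ n)

theorem map_logOneAdd [CompleteSpace A] {a : A} (ha : ‖a‖ < 1) (φ : A →A[ℝ] ℂ)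
    (hφ : ‖φ a‖ < 1) : φ (logOneAdd a) = Complex.log (1 + φ a) := by
  have hterm (n : ℕ) : φ (((-1 : ℝ) ^ (n + 1) / n) • a ^ n) = (-1) ^ (n + 1) * φ a ^ n / n := by
    rw [map_smul, map_pow, Complex.real_smul]
    push_cast
    ring
  refine ((summable_logOneAdd ha).hasSum.map φ φ.continuous).unique ?_
  exact (Complex.hasSum_taylorSeries_log hφ).congr_fun hterm

end LogOneAdd

section Neumann

variable {𝕜 E : Type*} [NontriviallyNormedField 𝕜] [NormedAddCommGroup E] [NormedSpace 𝕜 E]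
  {T : E →L[𝕜] E} {r : ℝ}

theorem norm_le_of_opNorm_le (hT : ‖T‖ ≤ r) (hr : r < 1) (x : E) :
    ‖x‖ ≤ (1 - r)⁻¹ * ‖x + T x‖ := by
  have h : ‖x‖ ≤ ‖x + T x‖ + r * ‖x‖ := by
    calc ‖x‖ = ‖x + T x - T x‖ := by rw [add_sub_cancel_right]
      _ ≤ ‖x + T x‖ + ‖T x‖ := norm_sub_le _ _
      _ ≤ ‖x + T x‖ + r * ‖x‖ := by gcongr; exact T.le_of_opNorm_le hT x
  rw [← div_eq_inv_mul, le_div_iff₀ (sub_pos.2 hr)]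
  linarith

theorem existsUnique_add_apply_eq [CompleteSpace E] (hT : ‖T‖ < 1) (b : E) :
    ∃! x, x + T x = b := by
  have hunit : IsUnit (1 + T) := by
    simpa using isUnit_one_sub_of_norm_lt_one ((norm_neg T).trans_lt hT)
  exact (ContinuousLinearMap.isUnit_iff_bijective.1 hunit).existsUnique b

end Neumann

theorem memℓp_one_iff {ι : Type*} {f : ι → ℝ} : Memℓp f 1 ↔ Summable fun i => ‖f i‖ := by
  simpa using memℓp_gen_iff (p := 1) (f := f) (by simp)

/-- The Banach space of absolutely summable real functions on `G`. For an additive commutative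
group `G` it is given below the structure of a Banach algebra with convolution as product. -/
abbrev EllOne.{u} (G : Type u) : Type u := lp (fun _ : G => ℝ) 1

namespace EllOne

section Algebra

variable {G : Type*}

theorem summable_norm (a : EllOne G) : Summable fun t => ‖a t‖ := memℓp_one_iff.1 a.2

theorem norm_eq_tsum (a : EllOne G) : ‖a‖ = ∑' t, ‖a t‖ := by
  simpa using lp.norm_eq_tsum_rpow (p := 1) (by simp) a

theorem continuous_apply (t : G) : Continuous fun a : EllOne G => a t :=
  (lp.evalCLM ℝ (fun _ : G => ℝ) 1 t).continuous

variable [AddCommGroup G]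

theorem summable_norm_mul_sub (a b : EllOne G) :
    Summable fun p : G × G => ‖a p.2 * b (p.1 - p.2)‖ :=
  _root_.summable_norm_mul_sub a.summable_norm b.summable_norm

theorem summable_mul_sub (a b : EllOne G) (s : G) : Summable fun r => a r * b (s - r) :=
  ((a.summable_norm_mul_sub b).prod_factor s).of_norm

theorem norm_tsum_mul_sub_le (a b : EllOne G) (s : G) :
    ‖∑' r, a r * b (s - r)‖ ≤ ∑' r, ‖a r * b (s - r)‖ :=
  norm_tsum_le_tsum_norm ((a.summable_norm_mul_sub b).prod_factor s)

theorem summable_norm_tsum_mul_sub (a b : EllOne G) :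
    Summable fun s => ‖∑' r, a r * b (s - r)‖ :=
  .of_nonneg_of_le (fun _ => norm_nonneg _) (a.norm_tsum_mul_sub_le b)
    (a.summable_norm_mul_sub b).prod

noncomputable instance : Mul (EllOne G) :=
  ⟨fun a b => ⟨fun s => ∑' r, a r * b (s - r), memℓp_one_iff.2 (a.summable_norm_tsum_mul_sub b)⟩⟩

open Classical in
noncomputable instance : One (EllOne G) := ⟨lp.single (E := fun _ : G => ℝ) 1 0 1⟩

theorem mul_apply (a b : EllOne G) (s : G) : (a * b) s = ∑' r, a r * b (s - r) := rfl

theorem one_apply [hG : DecidableEq G] (s : G) : (1 : EllOne G) s = if s = 0 then 1 else 0 := by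
  obtain rfl : hG = fun _ _ => Classical.propDecidable _ := Subsingleton.elim _ _
  classical
  exact (lp.single_apply _ _ _ _).trans (Pi.single_apply _ _ _)

protected theorem mul_comm (a b : EllOne G) : a * b = b * a := by
  ext s
  rw [mul_apply, mul_apply, ← (Equiv.subLeft s).tsum_eq]
  simp [mul_comm]

protected theorem one_mul (a : EllOne G) : 1 * a = a := by
  classical
  ext s
  rw [mul_apply, tsum_eq_single 0 fun r hr => by rw [one_apply, if_neg hr, zero_mul]]
  simp [one_apply]

protected theorem add_mul (a b c : EllOne G) : (a + b) * c = a * c + b * c := by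
  ext s
  simpa only [mul_apply, lp.coeFn_add, Pi.add_apply, add_mul] using
    (summable_mul_sub a c s).tsum_add (summable_mul_sub b c s)

protected theorem smul_mul (x : ℝ) (a b : EllOne G) : x • a * b = x • (a * b) := by
  ext s
  simp only [mul_apply, lp.coeFn_smul, Pi.smul_apply, smul_eq_mul, mul_assoc, tsum_mul_left]

protected theorem mul_assoc (a b c : EllOne G) : a * b * c = a * (b * c) := by
  ext s
  have hsum : Summable fun p : G × G => a p.2 * b (p.1 - p.2) * c (s - p.1) := by
    refine .of_norm_bounded ((a.summable_norm_mul_sub b).mul_right ‖c‖) fun p => ?_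
    rw [norm_mul]
    gcongr
    exact lp.norm_apply_le_norm one_ne_zero c _
  calc (a * b * c) s = ∑' q, ∑' r, a r * b (q - r) * c (s - q) := by
        simp only [mul_apply, tsum_mul_right]
    _ = ∑' r, ∑' q, a r * b (q - r) * c (s - q) :=
        (Summable.prod_symm hsum).tsum_comm (f := fun r q => a r * b (q - r) * c (s - q))
    _ = ∑' r, a r * ∑' q, b q * c (s - r - q) := by
        refine tsum_congr fun r => ?_
        rw [← (Equiv.addRight r).tsum_eq, ← tsum_mul_left]
        simp [mul_assoc, sub_sub, add_comm]
    _ = (a * (b * c)) s := rfl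

protected theorem norm_mul_le (a b : EllOne G) : ‖a * b‖ ≤ ‖a‖ * ‖b‖ := by
  calc ‖a * b‖ = ∑' s, ‖∑' r, a r * b (s - r)‖ := norm_eq_tsum _
    _ ≤ ∑' s, ∑' r, ‖a r * b (s - r)‖ :=
        (a.summable_norm_tsum_mul_sub b).tsum_le_tsum (a.norm_tsum_mul_sub_le b)
          (a.summable_norm_mul_sub b).prod
    _ = ‖a‖ * ‖b‖ := by
        simp only [norm_mul, norm_eq_tsum]
        exact tsum_tsum_mul_sub a.summable_norm.norm b.summable_norm.norm

noncomputable instance : NormedCommRing (EllOne G) where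
  __ := (inferInstance : NormedAddCommGroup (EllOne G))
  mul_assoc := EllOne.mul_assoc
  mul_comm := EllOne.mul_comm
  one_mul := EllOne.one_mul
  mul_one a := (EllOne.mul_comm a 1).trans a.one_mul
  right_distrib := EllOne.add_mul
  left_distrib a b c := by simp only [EllOne.mul_comm a, EllOne.add_mul]
  zero_mul a := by ext s; simp [mul_apply]
  mul_zero a := by ext s; simp [mul_apply]
  norm_mul_le := EllOne.norm_mul_le

noncomputable instance : NormedAlgebra ℝ (EllOne G) where
  __ := Algebra.ofModule EllOne.smul_mul fun x a b => by
    rw [mul_comm, EllOne.smul_mul, mul_comm b]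
  norm_smul_le := norm_smul_le

end Algebra

section Restrict

variable {G : Type*}

/-- The part of a function supported in `S`. -/
noncomputable def restrict (S : Set G) : EllOne G →L[ℝ] EllOne G :=
  LinearMap.mkContinuous
    { toFun a := ⟨S.indicator a, memℓp_one_iff.2 <| .of_nonneg_of_le (fun _ => norm_nonneg _)
        (fun _ => norm_indicator_le_norm_self a _) a.summable_norm⟩
      map_add' a b := lp.ext (Set.indicator_add S a b)
      map_smul' x a := lp.ext (Set.indicator_const_smul S x a) } 1 fun a =>
    (lp.norm_mono one_ne_zero fun _ => norm_indicator_le_norm_self a _).trans_eq (one_mul _).symm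

theorem restrict_apply (S : Set G) (a : EllOne G) (t : G) : restrict S a t = S.indicator a t := rfl

theorem restrict_apply_of_mem {S : Set G} (a : EllOne G) {t : G} (ht : t ∈ S) :
    restrict S a t = a t := Set.indicator_of_mem ht _

theorem restrict_apply_of_notMem {S : Set G} (a : EllOne G) {t : G} (ht : t ∉ S) :
    restrict S a t = 0 := Set.indicator_of_notMem ht _

theorem restrict_eq_self {S : Set G} {a : EllOne G} (ha : ∀ t ∉ S, a t = 0) : restrict S a = a :=
  lp.ext (Set.indicator_eq_self.2 fun _ ht => by_contra fun h => ht (ha _ h))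

theorem restrict_add_restrict_compl (S : Set G) (a : EllOne G) :
    restrict S a + restrict Sᶜ a = a := lp.ext (Set.indicator_self_add_compl S a)

theorem norm_restrict_le (S : Set G) : ‖restrict S‖ ≤ 1 :=
  LinearMap.mkContinuous_norm_le _ zero_le_one _

theorem tendsto_restrict {ι : Type*} {l : Filter ι} {S : ι → Set G} {u : EllOne G}
    (hS : ∀ t, u t ≠ 0 → ∀ᶠ i in l, t ∈ S i) :
    Tendsto (fun i => restrict (S i) u) l (𝓝 u) := by
  rw [tendsto_iff_norm_sub_tendsto_zero]
  simp only [norm_eq_tsum, lp.coeFn_sub, Pi.sub_apply]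
  rw [← tsum_zero (α := ℝ) (β := G)]
  refine tendsto_tsum_of_dominated_convergence u.summable_norm (fun t => ?_)
    (.of_forall fun i t => ?_)
  · refine tendsto_const_nhds.congr' ?_
    by_cases ht : u t = 0
    · simp [restrict_apply, Set.indicator_apply_eq_zero.2 fun _ => ht, ht]
    · filter_upwards [hS t ht] with i hi
      rw [restrict_apply_of_mem u hi, sub_self, norm_zero]
  · by_cases ht : t ∈ S i
    · simp [restrict_apply_of_mem u ht]
    · simp [restrict_apply_of_notMem u ht]

end Restrict

section Support

variable {G : Type*} [AddCommGroup G] {S : Set G} {x y : EllOne G}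

theorem mul_apply_of_notMem (hS : ∀ s ∈ S, ∀ t ∈ S, s + t ∈ S) (hx : ∀ t ∉ S, x t = 0)
    (hy : ∀ t ∉ S, y t = 0) {t : G} (ht : t ∉ S) : (x * y) t = 0 := by
  rw [mul_apply]
  refine (tsum_congr fun r => ?_).trans tsum_zero
  by_cases hr : r ∈ S
  · rw [hy _ fun h => ht (by simpa using hS _ hr _ h), mul_zero]
  · rw [hx r hr, zero_mul]

theorem pow_succ_apply_of_notMem (hS : ∀ s ∈ S, ∀ t ∈ S, s + t ∈ S) (hx : ∀ t ∉ S, x t = 0)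
    (n : ℕ) {t : G} (ht : t ∉ S) : (x ^ (n + 1)) t = 0 := by
  induction n generalizing t with
  | zero => simpa using hx t ht
  | succ n ih =>
    rw [pow_succ]
    exact mul_apply_of_notMem hS (fun _ => ih) hx ht

theorem exp_apply_of_notMem (hS : ∀ s ∈ S, ∀ t ∈ S, s + t ∈ S) (hx : ∀ t ∉ S, x t = 0)
    {t : G} (ht : t ∉ S) : (NormedSpace.exp x) t = (1 : EllOne G) t := by
  have hterms : HasSum (fun n : ℕ => ((n.factorial : ℝ)⁻¹ • x ^ n : EllOne G) t)
      ((NormedSpace.exp x) t) :=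
    (NormedSpace.exp_series_hasSum_exp' (𝕂 := ℝ) x).map
      (lp.evalCLM ℝ (fun _ : G => ℝ) 1 t) (continuous_apply t)
  refine hterms.unique ?_
  simpa using hasSum_single (f := fun n : ℕ => ((n.factorial : ℝ)⁻¹ • x ^ n : EllOne G) t) 0
    fun n hn => by
      obtain ⟨m, rfl⟩ := Nat.exists_eq_succ_of_ne_zero hn
      rw [lp.coeFn_smul, Pi.smul_apply, Nat.succ_eq_add_one,
        pow_succ_apply_of_notMem hS hx m ht, smul_zero]

end Support

section Compression

variable {G : Type*} [AddCommGroup G] {a b : EllOne G}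

/-- The compression to `S` of the operator of convolution by `a`. For `S` finite, its matrix is
a section of the Toeplitz matrix of `a`; for `S` a half-line, it is a Wiener–Hopf operator. -/
noncomputable def compression (S : Set G) (a : EllOne G) : EllOne G →L[ℝ] EllOne G :=
  restrict S ∘L (ContinuousLinearMap.mul ℝ (EllOne G)).flip a

theorem compression_apply (S : Set G) (a x : EllOne G) :
    compression S a x = restrict S (x * a) := rfl

theorem norm_compression_le (S : Set G) (a : EllOne G) : ‖compression S a‖ ≤ ‖a‖ := by
  refine ContinuousLinearMap.opNorm_le_bound _ (norm_nonneg a) fun x => ?_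
  calc ‖restrict S (x * a)‖ ≤ ‖x * a‖ := by
        simpa using (restrict S).le_of_opNorm_le (norm_restrict_le S) (x * a)
    _ ≤ ‖a‖ * ‖x‖ := (norm_mul_le x a).trans_eq (mul_comm _ _)

theorem existsUnique_add_compression_eq (ha : ‖a‖ < 1) (S : Set G) (b : EllOne G) :
    ∃! x, x + compression S a x = b :=
  existsUnique_add_apply_eq ((norm_compression_le S a).trans_lt ha) b

theorem tendsto_of_add_compression_eq {ι : Type*} {l : Filter ι} {S : ι → Set G}
    {x : ι → EllOne G} {u : EllOne G} (ha : ‖a‖ < 1)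
    (hx : ∀ i, x i + compression (S i) a (x i) = b)
    (hu : ∀ i, restrict (S i) (u + u * a) = b) (hS : ∀ t, u t ≠ 0 → ∀ᶠ i in l, t ∈ S i) :
    Tendsto x l (𝓝 u) := by
  rw [tendsto_iff_norm_sub_tendsto_zero]
  have hlim : Tendsto (fun i => (1 - ‖a‖)⁻¹ * ‖restrict (S i) u - u‖) l (𝓝 0) := by
    simpa using (tendsto_iff_norm_sub_tendsto_zero.1 (tendsto_restrict hS)).const_mul (1 - ‖a‖)⁻¹
  refine squeeze_zero (fun _ => norm_nonneg _) (fun i => ?_) hlim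
  have herror : x i - u + compression (S i) a (x i - u) = restrict (S i) u - u := by
    have hui := hu i
    rw [map_add, ← compression_apply] at hui
    rw [map_sub]
    linear_combination hx i - hui
  rw [← herror]
  exact norm_le_of_opNorm_le (norm_compression_le (S i) a) ha _

end Compression

section ExtendByZero

variable {ι G : Type*} [Finite ι] {e : ι → G}

/-- The extension by zero of a finite family `h` along an injection `e`. -/
noncomputable def extendByZero (e : ι → G) (h : ι → ℝ) : EllOne G :=
  ⟨Function.extend e h 0, memℓp_one_iff.2 <| summable_of_hasFiniteSupport <|
    (Set.finite_range e).subset fun t ht => by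
      by_contra hte
      exact ht (by simp [Function.extend_apply' _ _ _ hte])⟩

theorem extendByZero_apply (he : e.Injective) (h : ι → ℝ) (i : ι) :
    extendByZero e h (e i) = h i := he.extend_apply _ _ _

theorem extendByZero_apply_of_notMem (h : ι → ℝ) {t : G} (ht : t ∉ Set.range e) :
    extendByZero e h t = 0 := Function.extend_apply' _ _ _ ht

theorem extendByZero_comp (he : e.Injective) {x : EllOne G} (hx : ∀ t ∉ Set.range e, x t = 0) :
    extendByZero e (fun i => x (e i)) = x := by
  ext t
  by_cases ht : t ∈ Set.range e
  · obtain ⟨i, rfl⟩ := ht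
    exact extendByZero_apply he _ i
  · rw [extendByZero_apply_of_notMem _ ht, hx t ht]

theorem tsum_extendByZero {ι : Type*} [Fintype ι] {e : ι → G} (he : e.Injective) (h : ι → ℝ) :
    ∑' t, extendByZero e h t = ∑ i, h i := by
  rw [← tsum_fintype (L := .unconditional _), ← he.tsum_eq]
  · simp only [extendByZero_apply he]
  · exact fun t ht => by_contra fun h' => ht (extendByZero_apply_of_notMem h h')

end ExtendByZero

section FiniteSection

variable {ι G : Type*} [Fintype ι] [AddCommGroup G] {e : ι → G} {a b : EllOne G}

theorem extendByZero_mul_apply (he : e.Injective) (h : ι → ℝ) (a : EllOne G) (s : G) :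
    (extendByZero e h * a) s = ∑ j, h j * a (s - e j) := by
  rw [mul_apply, ← he.tsum_eq, tsum_fintype]
  · simp only [extendByZero_apply he]
  · intro r hr
    by_contra hre
    exact hr (by simp [extendByZero_apply_of_notMem h hre])

theorem extendByZero_add_compression_eq_iff (he : e.Injective) (hb : ∀ t ∉ Set.range e, b t = 0)
    (h : ι → ℝ) :
    extendByZero e h + compression (Set.range e) a (extendByZero e h) = b ↔
      ∀ i, h i + ∑ j, h j * a (e i - e j) = b (e i) := by
  have hrange (i : ι) : (extendByZero e h + compression (Set.range e) a (extendByZero e h)) (e i) =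
      h i + ∑ j, h j * a (e i - e j) := by
    rw [lp.coeFn_add, Pi.add_apply, extendByZero_apply he, compression_apply,
      restrict_apply_of_mem _ (Set.mem_range_self i), extendByZero_mul_apply he]
  refine ⟨fun hx i => by rw [← hrange, hx], fun hh => lp.ext (funext fun t => ?_)⟩
  by_cases ht : t ∈ Set.range e
  · obtain ⟨i, rfl⟩ := ht
    rw [hrange, hh]
  · rw [lp.coeFn_add, Pi.add_apply, extendByZero_apply_of_notMem h ht, compression_apply,
      restrict_apply_of_notMem _ ht, hb t ht, add_zero]

theorem existsUnique_finiteSection (ha : ‖a‖ < 1) (he : e.Injective)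
    (hb : ∀ t ∉ Set.range e, b t = 0) :
    ∃! h : ι → ℝ, ∀ i, h i + ∑ j, h j * a (e i - e j) = b (e i) := by
  simp only [← extendByZero_add_compression_eq_iff he hb]
  obtain ⟨x, hx, hunique⟩ := existsUnique_add_compression_eq ha (Set.range e) b
  have hsupp (t : G) (ht : t ∉ Set.range e) : x t = 0 := by
    rw [← hb t ht, ← hx, lp.coeFn_add, Pi.add_apply, compression_apply,
      restrict_apply_of_notMem _ ht, add_zero]
  refine ⟨fun i => x (e i), by simpa only [extendByZero_comp he hsupp] using hx, fun h hh => ?_⟩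
  ext i
  rw [← hunique _ hh, extendByZero_apply he]

end FiniteSection

section Even

variable {G : Type*} [AddCommGroup G] {a b : EllOne G}

theorem even_mul (ha : Function.Even a) (hb : Function.Even b) : Function.Even ↑(a * b) := by
  intro s
  rw [mul_apply, mul_apply, ← (Equiv.neg G).tsum_eq]
  refine tsum_congr fun r => ?_
  rw [Equiv.neg_apply, ha, ← hb, neg_sub_neg, neg_sub]

theorem even_pow (ha : Function.Even a) (n : ℕ) : Function.Even ↑(a ^ n) := by
  classical
  induction n with
  | zero => intro t; simp [one_apply]
  | succ n ih => rw [pow_succ]; exact even_mul ih ha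

theorem hasSum_logOneAdd_apply (ha : ‖a‖ < 1) (t : G) :
    HasSum (fun n : ℕ => (-1 : ℝ) ^ (n + 1) / n * (a ^ n) t) (logOneAdd a t) :=
  (summable_logOneAdd ha).hasSum.map (lp.evalCLM ℝ (fun _ : G => ℝ) 1 t) (continuous_apply t)

theorem even_logOneAdd (ha : ‖a‖ < 1) (heven : Function.Even a) :
    Function.Even (logOneAdd a : EllOne G) := fun t =>
  (hasSum_logOneAdd_apply ha (-t)).unique <| by
    simpa only [even_pow heven _ t] using hasSum_logOneAdd_apply ha t

end Even

section FourierSeries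

theorem norm_spectralTerm (k : ℤ → ℝ) (l : ℝ) (t : ℤ) : ‖spectralTerm k l t‖ = ‖k t‖ := by
  have hexp : Complex.I * l * t = ((l * t : ℝ) : ℂ) * Complex.I := by
    push_cast
    ring
  rw [spectralTerm, norm_mul, Complex.norm_real, hexp, Complex.norm_exp_ofReal_mul_I, one_mul]

theorem continuous_spectralTerm (k : ℤ → ℝ) (t : ℤ) : Continuous fun l => spectralTerm k l t := by
  unfold spectralTerm
  fun_prop

theorem summable_norm_spectralTerm (a : EllOne ℤ) (l : ℝ) :
    Summable fun t => ‖spectralTerm a l t‖ := by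
  simpa only [norm_spectralTerm] using a.summable_norm

theorem norm_tsum_spectralTerm_le (a : EllOne ℤ) (l : ℝ) : ‖∑' t, spectralTerm a l t‖ ≤ ‖a‖ := by
  rw [norm_eq_tsum, ← tsum_congr (norm_spectralTerm a l)]
  exact norm_tsum_le_tsum_norm (a.summable_norm_spectralTerm l)

theorem spectralTerm_mul (a b : EllOne ℤ) (l : ℝ) (s : ℤ) :
    spectralTerm (a * b : EllOne ℤ) l s = ∑' r, spectralTerm a l r * spectralTerm b l (s - r) := by
  simp only [spectralTerm, mul_apply, Complex.ofReal_tsum, ← tsum_mul_left]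
  refine tsum_congr fun r => ?_
  rw [mul_mul_mul_comm, ← Complex.exp_add, Complex.ofReal_mul]
  congr 2
  push_cast
  ring

theorem tsum_spectralTerm_mul (a b : EllOne ℤ) (l : ℝ) :
    ∑' t, spectralTerm (a * b : EllOne ℤ) l t =
      (∑' t, spectralTerm a l t) * ∑' t, spectralTerm b l t := by
  simp only [spectralTerm_mul]
  exact tsum_tsum_mul_sub (a.summable_norm_spectralTerm l) (b.summable_norm_spectralTerm l)

theorem tsum_spectralTerm_one (l : ℝ) : ∑' t, spectralTerm (1 : EllOne ℤ) l t = 1 := by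
  rw [tsum_eq_single 0 fun t ht => by simp [spectralTerm, one_apply, ht]]
  simp [spectralTerm, one_apply]

/-- The Fourier series at `l`, as a character of the convolution algebra. -/
noncomputable def fourierSeries (l : ℝ) : EllOne ℤ →A[ℝ] ℂ where
  toAlgHom := AlgHom.ofLinearMap
    { toFun a := ∑' t, spectralTerm a l t
      map_add' a b := by
        rw [← (a.summable_norm_spectralTerm l).of_norm.tsum_add
          (b.summable_norm_spectralTerm l).of_norm]
        exact tsum_congr fun t => by simp [spectralTerm, mul_add]
      map_smul' c a := by
        rw [RingHom.id_apply, Complex.real_smul, ← tsum_mul_left]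
        exact tsum_congr fun t => by simp [spectralTerm, mul_left_comm] }
    (tsum_spectralTerm_one l) fun a b => tsum_spectralTerm_mul a b l
  cont := (LinearMap.mkContinuous _ 1 fun a => by
    simpa using norm_tsum_spectralTerm_le a l).continuous

theorem hasSum_spectralTerm (a : EllOne ℤ) (l : ℝ) :
    HasSum (spectralTerm a l) (fourierSeries l a) :=
  (a.summable_norm_spectralTerm l).of_norm.hasSum

theorem norm_fourierSeries_le (l : ℝ) (a : EllOne ℤ) : ‖fourierSeries l a‖ ≤ ‖a‖ :=
  norm_tsum_spectralTerm_le a l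

theorem continuous_fourierSeries (a : EllOne ℤ) : Continuous fun l => fourierSeries l a :=
  continuous_tsum (continuous_spectralTerm a) a.summable_norm fun t l =>
    (norm_spectralTerm a l t).le

theorem integral_spectralTerm (k : ℤ → ℝ) (t : ℤ) :
    ∫ l in (0 : ℝ)..(2 * Real.pi), spectralTerm k l t =
      if t = 0 then 2 * Real.pi * (k 0 : ℂ) else 0 := by
  split_ifs with ht
  · simp [spectralTerm, ht]
  · have hc : Complex.I * t ≠ 0 := mul_ne_zero Complex.I_ne_zero (Int.cast_ne_zero.2 ht)
    have hperiod : Complex.exp (Complex.I * t * (2 * Real.pi : ℝ)) = 1 := by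
      rw [← Complex.exp_int_mul_two_pi_mul_I t]
      congr 1
      push_cast
      ring
    simp only [spectralTerm, intervalIntegral.integral_mul_const,
      mul_right_comm Complex.I _ (t : ℂ), integral_exp_mul_complex hc, hperiod]
    simp

theorem integral_fourierSeries (a : EllOne ℤ) :
    ∫ l in (0 : ℝ)..(2 * Real.pi), fourierSeries l a = 2 * Real.pi * a 0 := by
  refine (intervalIntegral.hasSum_integral_of_dominated_convergence (fun t _ => ‖a t‖)
    (fun t => (continuous_spectralTerm a t).aestronglyMeasurable)
    (fun t => .of_forall fun l _ => (norm_spectralTerm a l t).le)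
    (.of_forall fun _ _ => a.summable_norm) intervalIntegrable_const
    (.of_forall fun l _ => hasSum_spectralTerm a l)).unique ?_
  simpa only [integral_spectralTerm] using hasSum_ite_eq (0 : ℤ) (2 * Real.pi * a 0 : ℂ)

theorem mul_single_neg_apply_zero (a : EllOne ℤ) (n : ℤ) :
    (a * (lp.single 1 (-n) (1 : ℝ) : EllOne ℤ)) 0 = a n := by
  rw [mul_apply, tsum_eq_single n fun r hr => by simp [lp.single_apply, hr]]
  simp

theorem fourierSeries_injective {a b : EllOne ℤ} (h : ∀ l, fourierSeries l a = fourierSeries l b) :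
    a = b := by
  ext n
  have hcoeff := integral_fourierSeries (a * lp.single 1 (-n) (1 : ℝ))
  simp only [map_mul, h] at hcoeff
  simp only [← map_mul, integral_fourierSeries, mul_single_neg_apply_zero] at hcoeff
  simpa using hcoeff.symm

end FourierSeries

section Exp

variable {G : Type*} [AddCommGroup G]

noncomputable local instance : NormedAlgebra ℚ (EllOne G) := .restrictScalars ℚ ℝ _

theorem exp_add (a b : EllOne G) :
    NormedSpace.exp (a + b) = NormedSpace.exp a * NormedSpace.exp b :=
  NormedSpace.exp_add

theorem exp_smul_one (c : ℝ) :
    NormedSpace.exp (c • (1 : EllOne G)) = Real.exp c • (1 : EllOne G) := by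
  simpa only [Algebra.algebraMap_eq_smul_one, Real.exp_eq_exp_ℝ] using
    (NormedSpace.algebraMap_exp_comm (𝔸 := EllOne G) c).symm

theorem fourierSeries_exp (l : ℝ) (a : EllOne ℤ) :
    fourierSeries l (NormedSpace.exp a) = Complex.exp (fourierSeries l a) := by
  rw [NormedSpace.map_exp _ (fourierSeries l).continuous, Complex.exp_eq_exp_ℂ]

end Exp

section Log

variable {a : EllOne ℤ}

theorem fourierSeries_logOneAdd (ha : ‖a‖ < 1) (l : ℝ) :
    fourierSeries l (logOneAdd a) = Complex.log (1 + fourierSeries l a) :=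
  map_logOneAdd ha _ ((norm_fourierSeries_le l a).trans_lt ha)

theorem exp_logOneAdd (ha : ‖a‖ < 1) : NormedSpace.exp (logOneAdd a) = 1 + a :=
  fourierSeries_injective fun l => by
    have hne : 1 + fourierSeries l a ≠ 0 := Complex.slitPlane_ne_zero <|
      Complex.mem_slitPlane_of_norm_lt_one ((norm_fourierSeries_le l a).trans_lt ha)
    rw [fourierSeries_exp, fourierSeries_logOneAdd ha, Complex.exp_log hne, map_add, map_one]

end Log

section SpectralDensity

variable {a : EllOne ℤ}

theorem fourierSeries_eq_spectralDensity (ha : Function.Even a) (l : ℝ) :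
    fourierSeries l a = (spectralDensity a l : ℂ) := by
  have hconj (t : ℤ) : spectralTerm a l (-t) = starRingEnd ℂ (spectralTerm a l t) := by
    rw [spectralTerm, spectralTerm, ha, map_mul, Complex.conj_ofReal, ← Complex.exp_conj]
    simp
  refine (Complex.conj_eq_iff_re.1 ?_).symm
  calc starRingEnd ℂ (∑' t, spectralTerm a l t) = ∑' t, spectralTerm a l (-t) := by
        simp only [hconj, Complex.conj_tsum]
    _ = ∑' t, spectralTerm a l t := (Equiv.neg ℤ).tsum_eq _

theorem spectralDensity_smul (c : ℝ) (a : EllOne ℤ) (l : ℝ) :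
    spectralDensity (c • a : EllOne ℤ) l = c * spectralDensity a l :=
  (congrArg Complex.re (map_smul (fourierSeries l) c a)).trans (Complex.re_ofReal_mul _ _)

theorem one_add_spectralDensity_pos (ha : ‖a‖ < 1) (l : ℝ) : 0 < 1 + spectralDensity a l := by
  have h : |spectralDensity a l| ≤ ‖a‖ :=
    (Complex.abs_re_le_norm _).trans (norm_fourierSeries_le l a)
  linarith [neg_abs_le (spectralDensity a l)]

theorem continuous_log_one_add_spectralDensity (ha : ‖a‖ < 1) :
    Continuous fun l => Real.log (1 + spectralDensity a l) :=
  (continuous_const.add (Complex.continuous_re.comp (continuous_fourierSeries a))).log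
    fun l => (one_add_spectralDensity_pos ha l).ne'

theorem fourierSeries_logOneAdd_of_even (ha : ‖a‖ < 1) (heven : Function.Even a) (l : ℝ) :
    fourierSeries l (logOneAdd a) = (Real.log (1 + spectralDensity a l) : ℂ) := by
  rw [fourierSeries_logOneAdd ha, fourierSeries_eq_spectralDensity heven,
    Complex.ofReal_log (one_add_spectralDensity_pos ha l).le, Complex.ofReal_add,
    Complex.ofReal_one]

theorem integral_log_one_add_spectralDensity (ha : ‖a‖ < 1) (heven : Function.Even a) :
    ∫ l in (0 : ℝ)..(2 * Real.pi), Real.log (1 + spectralDensity a l) =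
      2 * Real.pi * logOneAdd a 0 := by
  have h := integral_fourierSeries (logOneAdd a)
  simp only [fourierSeries_logOneAdd_of_even ha heven, intervalIntegral.integral_ofReal] at h
  exact_mod_cast h

end SpectralDensity

section HalfLine

theorem hasSum_natCast {M : Type*} [AddCommMonoid M] [TopologicalSpace M] {f : ℤ → M}
    (hf : Summable f) (hneg : ∀ t < 0, f t = 0) : HasSum (fun n : ℕ => f n) (∑' t, f t) := by
  refine (Nat.cast_injective.hasSum_iff fun t ht => hneg t ?_).2 hf.hasSum
  contrapose! ht
  exact CanLift.prf t ht

theorem restrict_Ici_zero (a : EllOne ℤ) :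
    restrict (Set.Ici 0) a = a 0 • (1 : EllOne ℤ) + restrict (Set.Ioi 0) a := by
  ext t
  simp only [lp.coeFn_add, lp.coeFn_smul, Pi.add_apply, Pi.smul_apply, restrict_apply, one_apply]
  rcases lt_trichotomy t 0 with ht | rfl | ht
  · simp [ht.ne, ht.le, ht]
  · simp
  · simp [ht.ne', ht.le, ht]

theorem fourierSeries_zero (a : EllOne ℤ) : fourierSeries 0 a = (∑' t, a t : ℝ) := by
  rw [Complex.ofReal_tsum]
  exact tsum_congr fun t => by simp [spectralTerm]

theorem tsum_restrict_Iio_zero {a : EllOne ℤ} (ha : Function.Even a) :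
    ∑' t, restrict (Set.Iio 0) a t = ∑' t, restrict (Set.Ioi 0) a t := by
  rw [← (Equiv.neg ℤ).tsum_eq]
  exact tsum_congr fun t => by simp [restrict_apply, Set.indicator_apply, ha t]

theorem fourierSeries_zero_restrict_Ici {a : EllOne ℤ} (ha : Function.Even a) :
    fourierSeries 0 (restrict (Set.Ici 0) a) = (fourierSeries 0 a + a 0) / 2 := by
  have hsplit : fourierSeries 0 a =
      fourierSeries 0 (restrict (Set.Ici 0) a) + fourierSeries 0 (restrict (Set.Iio 0) a) := by
    rw [← Set.compl_Ici, ← map_add, restrict_add_restrict_compl]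
  have hreflect : fourierSeries 0 (restrict (Set.Ici 0) a) =
      a 0 + fourierSeries 0 (restrict (Set.Iio 0) a) := by
    rw [restrict_Ici_zero, map_add, map_smul, map_one, Complex.real_smul, mul_one,
      fourierSeries_zero (restrict (Set.Iio 0) a), tsum_restrict_Iio_zero ha,
      ← fourierSeries_zero]
  linear_combination (hreflect - hsplit) / 2

end HalfLine

section WienerHopf

variable {a : EllOne ℤ}

/-- The inverse of the Wiener–Hopf factor of `1 + a` supported on the non-negative integers. -/
noncomputable def wienerHopf (a : EllOne ℤ) : EllOne ℤ :=
  NormedSpace.exp (-restrict (Set.Ici 0) (logOneAdd a))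

theorem wienerHopf_mul_one_add (ha : ‖a‖ < 1) :
    wienerHopf a * (1 + a) = NormedSpace.exp (restrict (Set.Iio 0) (logOneAdd a)) := by
  rw [← exp_logOneAdd ha, wienerHopf, ← exp_add, ← Set.compl_Ici]
  congr 1
  linear_combination -restrict_add_restrict_compl (Set.Ici 0) (logOneAdd a)

theorem wienerHopf_apply_of_neg {t : ℤ} (ht : t < 0) : wienerHopf a t = 0 := by
  rw [wienerHopf, exp_apply_of_notMem (S := Set.Ici 0) (fun _ hs _ ht => add_nonneg hs ht)
    (fun t ht => by simp [restrict_apply_of_notMem _ ht]) ht.not_ge, one_apply, if_neg ht.ne]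

theorem wienerHopf_apply_zero (a : EllOne ℤ) :
    wienerHopf a 0 = Real.exp (-logOneAdd a 0) := by
  have hpos : NormedSpace.exp (-restrict (Set.Ioi 0) (logOneAdd a)) 0 = (1 : EllOne ℤ) 0 :=
    exp_apply_of_notMem (S := Set.Ioi 0) (fun _ hs _ ht => add_pos hs ht)
      (fun t ht => by simp [restrict_apply_of_notMem _ ht]) (lt_irrefl 0)
  rw [wienerHopf, restrict_Ici_zero, neg_add, ← neg_smul, exp_add, exp_smul_one, smul_mul_assoc,
    one_mul, lp.coeFn_smul, Pi.smul_apply, hpos, one_apply, if_pos rfl, smul_eq_mul, mul_one]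

theorem restrict_wienerHopf_add (ha : ‖a‖ < 1) {S : Set ℤ} (hS : S ⊆ Set.Ici 0) (h0 : 0 ∈ S) :
    restrict S (wienerHopf a + wienerHopf a * a) = 1 := by
  rw [← mul_one_add, wienerHopf_mul_one_add ha]
  ext t
  by_cases ht : t ∈ S
  · rw [restrict_apply_of_mem _ ht,
      exp_apply_of_notMem (S := Set.Iio 0) (fun _ hs _ ht => add_neg hs ht)
        (fun t ht => restrict_apply_of_notMem _ ht) (not_lt.2 (hS ht))]
  · rw [restrict_apply_of_notMem _ ht, one_apply, if_neg (by rintro rfl; exact ht h0)]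

theorem tsum_wienerHopf (ha : ‖a‖ < 1) (heven : Function.Even a) :
    ∑' t, wienerHopf a t =
      Real.exp (-(1 / 2) * Real.log (1 + spectralDensity a 0) - 1 / 2 * logOneAdd a 0) := by
  rw [← Complex.ofReal_inj, ← fourierSeries_zero, wienerHopf, fourierSeries_exp, map_neg,
    fourierSeries_zero_restrict_Ici (even_logOneAdd ha heven),
    fourierSeries_logOneAdd_of_even ha heven, Complex.ofReal_exp]
  congr 1
  push_cast
  ring

theorem hasSum_wienerHopf (a : EllOne ℤ) :
    HasSum (fun s : ℕ => wienerHopf a s) (∑' t, wienerHopf a t) :=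
  hasSum_natCast (wienerHopf a).summable_norm.of_norm fun _ => wienerHopf_apply_of_neg

end WienerHopf

section HalfLineSolution

variable {a : EllOne ℤ}

/-- The solution `g` of `g + g₊ * a = 1`, where `g₊` is the part of `g` supported on the
non-negative integers: for `‖a‖ < 1`, `g₊` is `wienerHopf a`, and the equation itself then gives
the values of `g` at negative integers. -/
noncomputable def halfLineSolution (a : EllOne ℤ) : EllOne ℤ := 1 - wienerHopf a * a

theorem restrict_wienerHopf (a : EllOne ℤ) : restrict (Set.Ici 0) (wienerHopf a) = wienerHopf a :=
  restrict_eq_self fun _ ht => wienerHopf_apply_of_neg (not_le.1 ht)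

theorem restrict_Ici_one : restrict (Set.Ici 0) (1 : EllOne ℤ) = 1 :=
  restrict_eq_self fun _ ht => by rw [one_apply, if_neg (not_le.1 ht).ne]

theorem wienerHopf_add_compression (ha : ‖a‖ < 1) :
    wienerHopf a + compression (Set.Ici 0) a (wienerHopf a) = 1 := by
  have h := restrict_wienerHopf_add ha subset_rfl (Set.mem_Ici.2 le_rfl)
  rwa [map_add, restrict_wienerHopf] at h

theorem restrict_halfLineSolution (ha : ‖a‖ < 1) :
    restrict (Set.Ici 0) (halfLineSolution a) = wienerHopf a := by
  rw [halfLineSolution, map_sub, restrict_Ici_one, ← compression_apply, sub_eq_iff_eq_add,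
    wienerHopf_add_compression ha]

theorem halfLineSolution_natCast (ha : ‖a‖ < 1) (n : ℕ) :
    halfLineSolution a n = wienerHopf a n := by
  rw [← restrict_halfLineSolution ha, restrict_apply_of_mem _
    (Set.mem_Ici.2 (Int.natCast_nonneg n))]

theorem halfLineSolution_apply_zero (ha : ‖a‖ < 1) (heven : Function.Even a) :
    halfLineSolution a 0 = Real.exp (-(1 / (2 * Real.pi)) *
      ∫ l in (0 : ℝ)..(2 * Real.pi), Real.log (1 + spectralDensity a l)) := by
  have hzero : halfLineSolution a 0 = wienerHopf a 0 := halfLineSolution_natCast ha 0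
  rw [hzero, wienerHopf_apply_zero, integral_log_one_add_spectralDensity ha heven]
  congr 1
  field

theorem hasSum_halfLineSolution (ha : ‖a‖ < 1) (heven : Function.Even a) :
    HasSum (fun s : ℕ => halfLineSolution a s)
      (Real.exp (-(1 / 2) * Real.log (1 + spectralDensity a 0) - (1 / (4 * Real.pi)) *
        ∫ l in (0 : ℝ)..(2 * Real.pi), Real.log (1 + spectralDensity a l))) := by
  simp only [halfLineSolution_natCast ha, integral_log_one_add_spectralDensity ha heven]
  convert hasSum_wienerHopf a using 1
  rw [tsum_wienerHopf ha heven]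
  congr 2
  field

theorem add_restrict_mul_eq_one_iff (ha : ‖a‖ < 1) (g : EllOne ℤ) :
    g + restrict (Set.Ici 0) g * a = 1 ↔ g = halfLineSolution a := by
  refine ⟨fun hg => ?_, ?_⟩
  · have hg_pos : restrict (Set.Ici 0) g + compression (Set.Ici 0) a (restrict (Set.Ici 0) g) =
        1 := by
      rw [compression_apply, ← map_add, hg, restrict_Ici_one]
    rw [(existsUnique_add_compression_eq ha _ _).unique hg_pos (wienerHopf_add_compression ha)]
      at hg
    exact eq_sub_of_add_eq hg
  · rintro rfl
    rw [restrict_halfLineSolution ha, halfLineSolution, sub_add_cancel]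

theorem hasSum_restrict_Ici_mul (a b : EllOne ℤ) (s : ℤ) :
    HasSum (fun r : ℕ => a r * b (s - r)) ((restrict (Set.Ici 0) a * b) s) := by
  refine (hasSum_natCast (summable_mul_sub _ b s) fun t ht => ?_).congr_fun fun r => ?_
  · rw [restrict_apply_of_notMem _ (Set.notMem_Ici.2 ht), zero_mul]
  · rw [restrict_apply_of_mem _ (Set.mem_Ici.2 (Int.natCast_nonneg r))]

theorem isHalfLineSolution_iff (α : ℝ) (k g : EllOne ℤ) :
    IsHalfLineSolution α k g ↔ g + restrict (Set.Ici 0) g * ((2 * α) • k) = 1 := by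
  simp only [IsHalfLineSolution, (hasSum_restrict_Ici_mul g k _).summable,
    (hasSum_restrict_Ici_mul g k _).tsum_eq, true_and, lp.ext_iff, funext_iff, lp.coeFn_add,
    mul_smul_comm, lp.coeFn_smul, Pi.add_apply, Pi.smul_apply, smul_eq_mul, one_apply]

theorem isHalfLineSolution_iff_eq {α : ℝ} {k : EllOne ℤ} (ha : ‖(2 * α) • k‖ < 1)
    (g : EllOne ℤ) : IsHalfLineSolution α k g ↔ g = halfLineSolution ((2 * α) • k) :=
  (isHalfLineSolution_iff α k g).trans (add_restrict_mul_eq_one_iff ha g)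

end HalfLineSolution

section TruncatedSolution

variable {α : ℝ} {k : EllOne ℤ}

/-- The inclusion of `{0, …, n - 1}` in `ℤ`; the truncated system of order `t` is the finite
section of the half-line equation along `finToInt (t + 1)`. -/
def finToInt (n : ℕ) (s : Fin n) : ℤ := (s : ℕ)

theorem finToInt_injective (n : ℕ) : (finToInt n).Injective :=
  Nat.cast_injective.comp Fin.val_injective

theorem mem_range_finToInt {n : ℕ} {s : ℤ} : s ∈ Set.range (finToInt n) ↔ 0 ≤ s ∧ s < n := by
  refine ⟨?_, fun hs => ⟨⟨s.toNat, by lia⟩, Int.toNat_of_nonneg hs.1⟩⟩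
  rintro ⟨i, rfl⟩
  simp [finToInt]

theorem one_apply_of_notMem_range_finToInt (t : ℕ) :
    ∀ s ∉ Set.range (finToInt (t + 1)), (1 : EllOne ℤ) s = 0 := fun s hs => by
  rw [one_apply, if_neg]
  rintro rfl
  exact hs (mem_range_finToInt.2 (by lia))

theorem isTruncatedSolution_iff (α : ℝ) (k : EllOne ℤ) (t : ℕ) (h : Fin (t + 1) → ℝ) :
    IsTruncatedSolution α k t h ↔
      ∀ s, h s + ∑ r, h r * ((2 * α) • k : EllOne ℤ) (finToInt _ s - finToInt _ r) =
        (1 : EllOne ℤ) (finToInt _ s) := by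
  simp only [IsTruncatedSolution, finToInt, one_apply, lp.coeFn_smul, Pi.smul_apply, smul_eq_mul,
    mul_left_comm _ (2 * α), ← Finset.mul_sum, Int.natCast_eq_zero, Fin.val_eq_zero_iff]

theorem existsUnique_isTruncatedSolution (ha : ‖(2 * α) • k‖ < 1) (t : ℕ) :
    ∃! h, IsTruncatedSolution α k t h := by
  simp only [isTruncatedSolution_iff]
  exact existsUnique_finiteSection ha (finToInt_injective _)
    (one_apply_of_notMem_range_finToInt t)

theorem tendsto_extendByZero_of_isTruncatedSolution (ha : ‖(2 * α) • k‖ < 1)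
    {h : ∀ t : ℕ, Fin (t + 1) → ℝ} (hh : ∀ t, IsTruncatedSolution α k t (h t)) :
    Tendsto (fun t => extendByZero (finToInt (t + 1)) (h t)) atTop
      (𝓝 (wienerHopf ((2 * α) • k))) := by
  refine tendsto_of_add_compression_eq ha (S := fun t => Set.range (finToInt (t + 1)))
    (fun t => (extendByZero_add_compression_eq_iff (finToInt_injective _)
      (one_apply_of_notMem_range_finToInt t) _).2 ((isTruncatedSolution_iff α k t _).1 (hh t)))
    (fun t => restrict_wienerHopf_add ha (fun s hs => (mem_range_finToInt.1 hs).1)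
      (mem_range_finToInt.2 (by lia))) fun s hs => ?_
  filter_upwards [eventually_ge_atTop s.toNat] with t ht
  have hs0 : 0 ≤ s := not_lt.1 fun h => hs (wienerHopf_apply_of_neg h)
  exact mem_range_finToInt.2 (by lia)

theorem tendsto_truncatedSolution (ha : ‖(2 * α) • k‖ < 1) {h : ℕ → ℕ → ℝ}
    (hh : ∀ t, IsTruncatedSolution α k t fun s => h t s) (s : ℕ) :
    Tendsto (fun t => h t s) atTop (𝓝 (halfLineSolution ((2 * α) • k) s)) := by
  rw [halfLineSolution_natCast ha]
  refine (((continuous_apply (s : ℤ)).tendsto _).comp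
    (tendsto_extendByZero_of_isTruncatedSolution ha hh)).congr' ?_
  filter_upwards [eventually_ge_atTop s] with t ht
  exact extendByZero_apply (finToInt_injective _) _ (⟨s, by lia⟩ : Fin (t + 1))

theorem tendsto_sum_truncatedSolution (ha : ‖(2 * α) • k‖ < 1) {h : ℕ → ℕ → ℝ}
    (hh : ∀ t, IsTruncatedSolution α k t fun s => h t s) :
    Tendsto (fun t => ∑ s ∈ Finset.range (t + 1), h t s) atTop
      (𝓝 (∑' s : ℕ, halfLineSolution ((2 * α) • k) s)) := by
  have htsum : ∑' s : ℕ, halfLineSolution ((2 * α) • k) s = ∑' s, wienerHopf ((2 * α) • k) s := by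
    simp only [halfLineSolution_natCast ha, (hasSum_wienerHopf _).tsum_eq]
  rw [htsum]
  refine (((lp.tsumCLM ℝ ℤ ℝ).continuous.tendsto _).comp
    (tendsto_extendByZero_of_isTruncatedSolution ha hh)).congr fun t => ?_
  rw [Finset.sum_range]
  exact tsum_extendByZero (finToInt_injective _) _

end TruncatedSolution

end EllOne

theorem proposition3_general (k : ℤ → ℝ) (hk : Function.Even k)
    (M : ℝ) (hM : HasSum (fun t : ℤ => |k t|) M) (α : ℝ) (hαM : 2 * M * |α| < 1) :
    (∀ l : ℝ, HasSum (spectralTerm k l) (spectralDensity k l : ℂ)) ∧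
    (∀ l : ℝ, 0 < 1 + 2 * α * spectralDensity k l) ∧
    IntervalIntegrable (fun l : ℝ => Real.log (1 + 2 * α * spectralDensity k l))
      MeasureTheory.volume 0 (2 * Real.pi) ∧
    (∀ t : ℕ, ∃! h : Fin (t + 1) → ℝ, IsTruncatedSolution α k t h) ∧
    ∃ g : ℤ → ℝ,
      (Memℓp g 1 ∧ IsHalfLineSolution α k g) ∧
      (∀ g' : ℤ → ℝ, Memℓp g' 1 → IsHalfLineSolution α k g' → g' = g) ∧
      g 0 = Real.exp (-(1 / (2 * Real.pi)) *
        ∫ l in (0 : ℝ)..(2 * Real.pi), Real.log (1 + 2 * α * spectralDensity k l)) ∧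
      HasSum (fun s : ℕ => g s)
        (Real.exp (-(1 / 2) * Real.log (1 + 2 * α * spectralDensity k 0) -
          (1 / (4 * Real.pi)) *
            ∫ l in (0 : ℝ)..(2 * Real.pi), Real.log (1 + 2 * α * spectralDensity k l))) ∧
      ∀ gt : ℕ → ℕ → ℝ,
        (∀ t : ℕ, IsTruncatedSolution α k t (fun s : Fin (t + 1) => gt t s)) →
        (∀ s : ℕ, Tendsto (fun t : ℕ => gt t s) atTop (𝓝 (g s))) ∧
        Tendsto (fun t : ℕ => ∑ s ∈ Finset.range (t + 1), gt t s) atTop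
          (𝓝 (∑' s : ℕ, g s)) := by
  obtain ⟨k, rfl⟩ : ∃ k' : EllOne ℤ, k = k' := ⟨⟨k, memℓp_one_iff.2 hM.summable⟩, rfl⟩
  have ha : ‖(2 * α) • k‖ < 1 := by
    simpa [norm_smul, EllOne.norm_eq_tsum, hM.tsum_eq, mul_right_comm] using hαM
  have heven : Function.Even ((2 * α) • k : EllOne ℤ) := fun t => by
    simp only [lp.coeFn_smul, Pi.smul_apply, hk t]
  simp only [← EllOne.spectralDensity_smul]
  refine ⟨fun l => ?_, EllOne.one_add_spectralDensity_pos ha,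
    (EllOne.continuous_log_one_add_spectralDensity ha).intervalIntegrable _ _,
    EllOne.existsUnique_isTruncatedSolution ha, EllOne.halfLineSolution ((2 * α) • k),
    ⟨lp.memℓp _, (EllOne.isHalfLineSolution_iff_eq ha _).2 rfl⟩,
    fun g' hg' hsol =>
      congrArg Subtype.val ((EllOne.isHalfLineSolution_iff_eq ha ⟨g', hg'⟩).1 hsol),
    EllOne.halfLineSolution_apply_zero ha heven, EllOne.hasSum_halfLineSolution ha heven,
    fun gt hgt => ⟨EllOne.tendsto_truncatedSolution ha hgt,
      EllOne.tendsto_sum_truncatedSolution ha hgt⟩⟩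
  rw [← EllOne.fourierSeries_eq_spectralDensity hk]
  exact EllOne.hasSum_spectralTerm k l

theorem proposition3 (k : ℤ → ℝ) (hk : IsPositiveDefiniteSymm k)
    (M : ℝ) (hM : HasSum (fun t : ℤ => |k t|) M)
    (α : ℝ) (hα : 0 ≤ α) (hαM : 2 * M * α < 1) :
    -- the spectral density is a well-defined real function and the logarithms make sense
    (∀ l : ℝ, HasSum (spectralTerm k l) (spectralDensity k l : ℂ)) ∧
    (∀ l : ℝ, 0 < 1 + 2 * α * spectralDensity k l) ∧
    IntervalIntegrable (fun l : ℝ => Real.log (1 + 2 * α * spectralDensity k l))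
      MeasureTheory.volume 0 (2 * Real.pi) ∧
    -- the truncated systems have unique solutions
    (∀ t : ℕ, ∃! h : Fin (t + 1) → ℝ, IsTruncatedSolution α k t h) ∧
    ∃ g : ℤ → ℝ,
      -- `g` is the unique solution in `L¹(ℤ)`
      (Memℓp g 1 ∧ IsHalfLineSolution α k g) ∧
      (∀ g' : ℤ → ℝ, Memℓp g' 1 → IsHalfLineSolution α k g' → g' = g) ∧
      -- its value at `0` and its sum over the half-line
      g 0 = Real.exp (-(1 / (2 * Real.pi)) *
        ∫ l in (0 : ℝ)..(2 * Real.pi), Real.log (1 + 2 * α * spectralDensity k l)) ∧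
      HasSum (fun s : ℕ => g s)
        (Real.exp (-(1 / 2) * Real.log (1 + 2 * α * spectralDensity k 0) -
          (1 / (4 * Real.pi)) *
            ∫ l in (0 : ℝ)..(2 * Real.pi), Real.log (1 + 2 * α * spectralDensity k l))) ∧
      -- convergence of the truncated solutions, pointwise and in sum
      ∀ gt : ℕ → ℕ → ℝ,
        (∀ t : ℕ, IsTruncatedSolution α k t (fun s : Fin (t + 1) => gt t s)) →
        (∀ s : ℕ, Filter.Tendsto (fun t : ℕ => gt t s) Filter.atTop (nhds (g s))) ∧
        Filter.Tendsto (fun t : ℕ => ∑ s ∈ Finset.range (t + 1), gt t s) Filter.atTop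
          (nhds (∑' s : ℕ, g s)) :=
  proposition3_general k (fun t => by simpa using hk.isHermitian.apply t 0) M hM α
    (by rwa [abs_of_nonneg hα])
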